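/- Let $F$ be a field, $n\ge 0$, and let $A,B\in F^{n\times n}$. The minimal ranks of the pencil $A+\lambda B$ are the pair $\rho(A,B)=(r,s)$ with $$s=\min_{(t,u)\in F^2\setminus\{0\}}\operatorname{rank}(tA+uB),\qquad r=\min_{(t',u')\in F^2\setminus \operatorname{span}\{(t^\star,u^\star)\}}\operatorname{rank}(t'A+u'B),$$ where $(t^\star,u^\star)$ is any minimizer in the definition of $s$ (the value of $r$ does not depend on its choice). The pencil is regular if $\det(\mu A+\lambda B)$ is not the zero polynomial in $F[\mu,\lambda]$. Its elementary divisors (finite and infinite, in homogeneous coordinates, up to nonzero scalars) are the powers $p^e$, $e\ge 1$, of irreducible polynomials $p\in F[\mu,\lambda]$ that occur with exact exponent $e$ in the factorization of one of the invariant polynomials $D_{k+1}/D_k$ with $D_{k+1}\neq 0$, where $D_k$ is the greatest common divisor of the $k\times k$ minors of $\mu A+\lambda B$ (and $D_0=1$); the powers of $\mu$ are the infinite elementary divisors. Then $\rho(A,B)=(n,n)$ if and only if $A+\lambda B$ is regular and none of its elementary divisors is a power of a linear form $\alpha\mu+\beta\lambda$ with $(\alpha,\beta)\in F^2\setminus\{0\}$.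 Moreover, if $F=\mathbb{R}$, then $\rho(A,B)=(n,n)$ if and only if there is a matrix $Q\in\mathbb{R}^{n\times n}$ without real eigenvalues such that $A+\lambda B$ is $\mathrm{GL}_n(\mathbb{R})\times\mathrm{GL}_n(\mathbb{R})\times\mathrm{GL}_2(\mathbb{R})$-equivalent to $Q+\lambda E$, where $E$ is the identity matrix; that is, $Q=P(t_{11}A+t_{12}B)U^{\mathsf T}$ and $E=P(t_{21}A+t_{22}B)U^{\mathsf T}$ for some $P,U\in \mathrm{GL}_n(\mathbb{R})$ and $(t_{ij})\in\mathrm{GL}_2(\mathbb{R})$. -/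

import Mathlib

namespace MatrixPencil

/-! An `m × n` pencil `μ A + λ B` over `F` is represented by the pair `(A, B)`; in non-homogeneous
coordinates it reads `A + λ B`. -/

/-- The member `t A + u B` of the pencil, where `v = (t, u)`. -/
def comb {F : Type*} [Field F] {m n : ℕ} (A B : Matrix (Fin m) (Fin n) F) (v : Fin 2 → F) :
    Matrix (Fin m) (Fin n) F :=
  v 0 • A + v 1 • B

/-- `s = min_{(t,u) ≠ 0} rank (t A + u B)`. -/
noncomputable def lowerRank {F : Type*} [Field F] {m n : ℕ} (A B : Matrix (Fin m) (Fin n) F) : ℕ :=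
  sInf {k : ℕ | ∃ v : Fin 2 → F, v ≠ 0 ∧ (comb A B v).rank = k}

/-- `v ≠ 0` attains the minimum that defines `lowerRank`. -/
def IsMinimizer {F : Type*} [Field F] {m n : ℕ} (A B : Matrix (Fin m) (Fin n) F)
    (v : Fin 2 → F) : Prop :=
  v ≠ 0 ∧ (comb A B v).rank = lowerRank A B

/-- `min_{(t',u') ∉ span {v}} rank (t' A + u' B)`. -/
noncomputable def rankOffSpan {F : Type*} [Field F] {m n : ℕ} (A B : Matrix (Fin m) (Fin n) F)
    (v : Fin 2 → F) : ℕ :=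
  sInf {k : ℕ | ∃ w : Fin 2 → F, w ∉ Submodule.span F {v} ∧ (comb A B w).rank = k}

theorem exists_isMinimizer {F : Type*} [Field F] {m n : ℕ} (A B : Matrix (Fin m) (Fin n) F) :
    ∃ v, IsMinimizer A B v := by
  have hne : {k : ℕ | ∃ v : Fin 2 → F, v ≠ 0 ∧ (comb A B v).rank = k}.Nonempty :=
    ⟨_, fun _ => 1, fun h => one_ne_zero (congrFun h 0), rfl⟩
  obtain ⟨v, hv, h⟩ := Nat.sInf_mem hne
  exact ⟨v, hv, h⟩

/-- If two minimizers are not collinear, each is available off the span of the other, and then the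
minimum off the span equals `lowerRank`. -/
theorem rankOffSpan_eq_lowerRank {F : Type*} [Field F] {m n : ℕ} {A B : Matrix (Fin m) (Fin n) F}
    {v w : Fin 2 → F} (hw : IsMinimizer A B w) (h : w ∉ Submodule.span F {v}) :
    rankOffSpan A B v = lowerRank A B := by
  apply le_antisymm
  · exact Nat.sInf_le ⟨w, h, hw.2⟩
  · refine le_csInf ⟨_, w, h, rfl⟩ ?_
    rintro k ⟨x, hx, rfl⟩
    refine Nat.sInf_le ⟨x, ?_, rfl⟩
    rintro rfl
    exact hx (Submodule.zero_mem _)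

/-- The value of `rankOffSpan` does not depend on the minimizer. -/
theorem rankOffSpan_eq {F : Type*} [Field F] {m n : ℕ} {A B : Matrix (Fin m) (Fin n) F}
    {v w : Fin 2 → F} (hv : IsMinimizer A B v) (hw : IsMinimizer A B w) :
    rankOffSpan A B v = rankOffSpan A B w := by
  by_cases h : w ∈ Submodule.span F {v}
  · have hs : Submodule.span F {v} = Submodule.span F {w} := by
      obtain ⟨c, rfl⟩ := Submodule.mem_span_singleton.1 h
      have hc : c ≠ 0 := by
        rintro rfl
        exact hw.1 (zero_smul _ _)
      exact (Submodule.span_singleton_smul_eq (IsUnit.mk0 c hc) v).symm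
    unfold rankOffSpan
    rw [hs]
  · have h' : v ∉ Submodule.span F {w} := by
      intro hvw
      obtain ⟨c, hc⟩ := Submodule.mem_span_singleton.1 hvw
      have hc0 : c ≠ 0 := by
        rintro rfl
        exact hv.1 (by rw [← hc, zero_smul])
      exact h (Submodule.mem_span_singleton.2 ⟨c⁻¹, by rw [← hc, inv_smul_smul₀ hc0]⟩)
    rw [rankOffSpan_eq_lowerRank hw h, rankOffSpan_eq_lowerRank hv h']

/-- The minimal ranks `ρ(A, B) = (r, s)`. The choice of the minimizer is immaterial by
`rankOffSpan_eq`. -/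
noncomputable def minimalRanks {F : Type*} [Field F] {m n : ℕ} (A B : Matrix (Fin m) (Fin n) F) :
    ℕ × ℕ :=
  (rankOffSpan A B (exists_isMinimizer A B).choose, lowerRank A B)

/-- The matrix `μ A + λ B` over `F[μ, λ]`, with `μ = X 0` and `λ = X 1`. -/
noncomputable def homog {F : Type*} [Field F] {m n : ℕ} (A B : Matrix (Fin m) (Fin n) F) :
    Matrix (Fin m) (Fin n) (MvPolynomial (Fin 2) F) :=
  (MvPolynomial.X 0 : MvPolynomial (Fin 2) F) • A.map MvPolynomial.C +
    (MvPolynomial.X 1 : MvPolynomial (Fin 2) F) • B.map MvPolynomial.C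

/-- A square pencil is regular if `det (μ A + λ B)` is not the zero polynomial. -/
def IsRegular {F : Type*} [Field F] {n : ℕ} (A B : Matrix (Fin n) (Fin n) F) : Prop :=
  (homog A B).det ≠ 0

/-- `D` is a `k`-th determinantal divisor of `M`: a greatest common divisor of all the minors of
order `k` of `M`. It is unique up to a unit. -/
def IsDeterminantalDivisor {R : Type*} [CommRing R] {m n : ℕ} (M : Matrix (Fin m) (Fin n) R)
    (k : ℕ) (D : R) : Prop :=
  (∀ (f : Fin k ↪o Fin m) (g : Fin k ↪o Fin n), D ∣ (M.submatrix f g).det) ∧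
    ∀ d : R, (∀ (f : Fin k ↪o Fin m) (g : Fin k ↪o Fin n), d ∣ (M.submatrix f g).det) → d ∣ D

/-- `i` is an invariant polynomial (invariant factor) of `M`: a quotient `D_{k+1} / D_k` of
consecutive determinantal divisors, where `D_{k+1} ≠ 0`. -/
def IsInvariantFactor {R : Type*} [CommRing R] {m n : ℕ} (M : Matrix (Fin m) (Fin n) R)
    (i : R) : Prop :=
  ∃ (k : ℕ) (D D' : R), IsDeterminantalDivisor M k D ∧ IsDeterminantalDivisor M (k + 1) D' ∧
    D' ≠ 0 ∧ D' = D * i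

/-- `q` is an elementary divisor of the pencil, in homogeneous coordinates: `q = p ^ e`, `e ≥ 1`,
where `p` is irreducible over `F` and `p ^ e` is the exact power of `p` in the factorization of an
invariant polynomial of `μ A + λ B`. As usual these are determined up to nonzero scalars.
The divisors that are powers of `μ` are the infinite elementary divisors of `A + λ B`; setting
`μ = 1` in the others yields the finite ones. -/
def IsElementaryDivisor {F : Type*} [Field F] {m n : ℕ} (A B : Matrix (Fin m) (Fin n) F)
    (q : MvPolynomial (Fin 2) F) : Prop :=
  ∃ (i p : MvPolynomial (Fin 2) F) (e : ℕ), IsInvariantFactor (homog A B) i ∧ Irreducible p ∧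
    1 ≤ e ∧ p ^ e ∣ i ∧ ¬ p ^ (e + 1) ∣ i ∧ q = p ^ e

/-- `q` is a power of a nonzero linear form `α μ + β λ` with coefficients in `F`. -/
def IsPowerOfLinearForm {F : Type*} [Field F] (q : MvPolynomial (Fin 2) F) : Prop :=
  ∃ (α β : F) (e : ℕ), (α, β) ≠ (0, 0) ∧
    q = (MvPolynomial.C α * MvPolynomial.X 0 + MvPolynomial.C β * MvPolynomial.X 1) ^ e

/-- The action of `GL_m(F) × GL_n(F) × GL_2(F)` on `m × n` pencils:
`(P, U, T) · (μ A + λ B) = μ P (t₁₁ A + t₁₂ B) Uᵀ + λ P (t₂₁ A + t₂₂ B) Uᵀ`. -/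
def act {F : Type*} [Field F] {m n : ℕ} (P : Matrix.GeneralLinearGroup (Fin m) F)
    (U : Matrix.GeneralLinearGroup (Fin n) F) (T : Matrix.GeneralLinearGroup (Fin 2) F)
    (A B : Matrix (Fin m) (Fin n) F) : Matrix (Fin m) (Fin n) F × Matrix (Fin m) (Fin n) F :=
  (P.val * (T.val 0 0 • A + T.val 0 1 • B) * U.val.transpose,
    P.val * (T.val 1 0 • A + T.val 1 1 • B) * U.val.transpose)

/-- The orbit `𝒪(A, B)`. -/
def orbit {F : Type*} [Field F] {m n : ℕ} (A B : Matrix (Fin m) (Fin n) F) :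
    Set (Matrix (Fin m) (Fin n) F × Matrix (Fin m) (Fin n) F) :=
  {C | ∃ P U T, C = act P U T A B}

end MatrixPencil

/-! The minimal ranks are `(n, n)` exactly when the binary form `φ = det (μ A + λ B)` of degree `n`
has no zero in `F² \ {0}`. A binary form vanishes at `(β, -α)` if and only if it is divisible by
`α μ + β λ`, and a prime divides `φ ≠ 0`, which is the product of the invariant polynomials, if and
only if it divides one of them. For the canonical form, the absence of zeros is invariant under the
group action, `B` is invertible when it holds, and `det (t Q + u E)` is, up to sign and
homogenization, the characteristic polynomial of `Q`. -/

namespace MatrixPencil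

open MvPolynomial

section Minors

variable {R : Type*} [CommRing R] {m n : ℕ} {M : Matrix (Fin m) (Fin n) R}

theorem dvd_minor_succ {k : ℕ} {d : R}
    (h : ∀ (f : Fin k ↪o Fin m) (g : Fin k ↪o Fin n), d ∣ (M.submatrix f g).det)
    (f : Fin (k + 1) ↪o Fin m) (g : Fin (k + 1) ↪o Fin n) : d ∣ (M.submatrix f g).det := by
  rw [Matrix.det_succ_row_zero]
  exact Finset.dvd_sum fun j _ => Dvd.dvd.mul_left
    (h ((Fin.succOrderEmb k).trans f) ((Fin.succAboveOrderEmb j).trans g)) _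

theorem IsDeterminantalDivisor.dvd_of_le {k l : ℕ} {D D' : R} (hD : IsDeterminantalDivisor M k D)
    (hD' : IsDeterminantalDivisor M l D') (hkl : k ≤ l) : D ∣ D' := by
  refine hD'.2 D ?_
  clear hD'
  induction l, hkl using Nat.le_induction with
  | base => exact hD.1
  | succ l _ ih => exact dvd_minor_succ ih

theorem IsDeterminantalDivisor.eq_zero_of_lt {k : ℕ} {D : R} (hD : IsDeterminantalDivisor M k D)
    (hk : n < k) : D = 0 := by
  refine zero_dvd_iff.1 (hD.2 0 fun _ g => ?_)
  have hkn : k ≤ n := by simpa using Fintype.card_le_of_embedding g.toEmbedding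
  exact absurd hkn hk.not_ge

theorem isDeterminantalDivisor_zero_one (M : Matrix (Fin m) (Fin n) R) :
    IsDeterminantalDivisor M 0 1 := by
  refine ⟨fun _ _ => one_dvd _, fun d hd => ?_⟩
  simpa using hd (OrderEmbedding.ofIsEmpty) (OrderEmbedding.ofIsEmpty)

theorem orderEmbedding_eq_refl {α : Type*} [LinearOrder α] [Finite α] (f : α ↪o α) :
    f = RelEmbedding.refl _ := by
  rw [← OrderEmbedding.range_inj, (Finite.surjective_of_injective f.injective).range_eq]
  exact Set.range_id.symm

theorem isDeterminantalDivisor_det (M : Matrix (Fin n) (Fin n) R) :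
    IsDeterminantalDivisor M n M.det := by
  refine ⟨fun f g => ?_, fun d hd => ?_⟩
  · simp [orderEmbedding_eq_refl f, orderEmbedding_eq_refl g]
  · simpa using hd (RelEmbedding.refl _) (RelEmbedding.refl _)

theorem exists_isDeterminantalDivisor [IsGCDMonoid R] (M : Matrix (Fin m) (Fin n) R) (k : ℕ) :
    ∃ D, IsDeterminantalDivisor M k D := by
  classical
  obtain ⟨_⟩ : Nonempty (NormalizedGCDMonoid R) := inferInstance
  let _ := Fintype.ofFinite ((Fin k ↪o Fin m) × (Fin k ↪o Fin n))
  exact ⟨Finset.univ.gcd fun p : (Fin k ↪o Fin m) × (Fin k ↪o Fin n) =>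
      (M.submatrix p.1 p.2).det,
    fun f g => Finset.gcd_dvd (Finset.mem_univ (f, g)),
    fun _ hd => Finset.dvd_gcd fun p _ => hd p.1 p.2⟩

theorem IsInvariantFactor.ne_zero {i : R} (hi : IsInvariantFactor M i) : i ≠ 0 := by
  obtain ⟨_, _, _, _, _, hD', rfl⟩ := hi
  exact right_ne_zero_of_mul hD'

theorem IsInvariantFactor.dvd_det {M : Matrix (Fin n) (Fin n) R} {i : R}
    (hi : IsInvariantFactor M i) : i ∣ M.det := by
  obtain ⟨k, D, D', -, hD', h0, rfl⟩ := hi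
  have hkn : k + 1 ≤ n := not_lt.1 fun hlt => h0 (hD'.eq_zero_of_lt hlt)
  exact (dvd_mul_left i D).trans (hD'.dvd_of_le (isDeterminantalDivisor_det M) hkn)

theorem IsDeterminantalDivisor.exists_isInvariantFactor_dvd [IsGCDMonoid R] {p : R} (hp : Prime p)
    {k : ℕ} {D : R} (hD : IsDeterminantalDivisor M k D) (h0 : D ≠ 0) (hpD : p ∣ D) :
    ∃ i, IsInvariantFactor M i ∧ p ∣ i := by
  induction k generalizing D with
  | zero =>
    have hD1 : D ∣ 1 := hD.dvd_of_le (isDeterminantalDivisor_zero_one M) le_rfl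
    exact absurd (isUnit_of_dvd_one (hpD.trans hD1)) hp.not_isUnit
  | succ k ih =>
    obtain ⟨D₀, hD₀⟩ := exists_isDeterminantalDivisor M k
    obtain ⟨i, rfl⟩ := hD₀.dvd_of_le hD k.le_succ
    rcases hp.dvd_or_dvd hpD with hpD₀ | hpi
    · exact ih hD₀ (left_ne_zero_of_mul h0) hpD₀
    · exact ⟨i, ⟨k, D₀, _, hD₀, hD, h0, rfl⟩, hpi⟩

end Minors

section HomogeneousPolynomials

theorem isHomogeneous_det {ι σ R : Type*} [Fintype ι] [DecidableEq ι] [CommRing R]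
    {M : Matrix ι ι (MvPolynomial σ R)} {d : ℕ} (hM : ∀ i j, (M i j).IsHomogeneous d) :
    M.det.IsHomogeneous (Fintype.card ι * d) := by
  rw [Matrix.det_apply']
  refine IsHomogeneous.sum _ _ _ fun τ _ => ?_
  have hprod : (∏ i, M (τ i) i).IsHomogeneous (Fintype.card ι * d) := by
    simpa using IsHomogeneous.prod Finset.univ _ _ fun i _ => hM (τ i) i
  simpa using hprod.C_mul ((Equiv.Perm.sign τ : ℤ) : R)

theorem eval₂_smul_of_isHomogeneous {σ R S : Type*} [CommSemiring R] [CommSemiring S]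
    {φ : MvPolynomial σ R} {d : ℕ} (hφ : φ.IsHomogeneous d) (f : R →+* S) (c : S) (g : σ → S) :
    φ.eval₂ f (c • g) = c ^ d * φ.eval₂ f g := by
  rw [eval₂_eq, eval₂_eq, Finset.mul_sum]
  refine Finset.sum_congr rfl fun s hs => ?_
  simp only [Pi.smul_apply, smul_eq_mul, mul_pow, Finset.prod_mul_distrib,
    Finset.prod_pow_eq_pow_sum, ← hφ.degree_eq_sum_deg_support hs]
  ring

/-- Modulo the ideal of the point `v` of projective space, the vectors `v i • X` and `X i • v`
coincide, and homogeneity of `φ` turns this into a congruence of values. -/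
theorem C_pow_mul_sub_X_pow_mul_mem_span {σ R : Type*} [CommRing R] {φ : MvPolynomial σ R} {d : ℕ}
    (hφ : φ.IsHomogeneous d) (v : σ → R) (i : σ) :
    C (v i) ^ d * φ - X i ^ d * C (eval v φ) ∈
      Ideal.span (Set.range fun j => C (v i) * X j - C (v j) * X i) := by
  let π := Ideal.Quotient.mk (Ideal.span (Set.range fun j => C (v i) * X j - C (v j) * X i))
  have hcongr : π (C (v i)) • (fun j => π (X j)) = π (X i) • (fun j => π (C (v j))) := by
    ext j
    simp only [Pi.smul_apply, smul_eq_mul, ← map_mul, mul_comm (X i)]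
    exact Ideal.Quotient.eq.2 (Ideal.subset_span ⟨j, rfl⟩)
  have hX : φ.eval₂ (π.comp C) (fun j => π (X j)) = π φ := by
    simpa only [eval₂_eta, Function.comp_def] using (eval₂_comp_left π C X φ).symm
  have hC : φ.eval₂ (π.comp C) (fun j => π (C (v j))) = π (C (eval v φ)) :=
    (eval₂_comp_left (π.comp C) (RingHom.id R) v φ).symm
  refine Ideal.Quotient.eq.1 ?_
  rw [map_mul, map_mul, map_pow, map_pow]
  calc π (C (v i)) ^ d * π φ
      = φ.eval₂ (π.comp C) (π (C (v i)) • fun j => π (X j)) := by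
        rw [eval₂_smul_of_isHomogeneous hφ, hX]
    _ = π (X i) ^ d * π (C (eval v φ)) := by
        rw [hcongr, eval₂_smul_of_isHomogeneous hφ, hC]

variable {F : Type*} [Field F]

theorem irreducible_of_isHomogeneous_one {σ : Type*} {φ : MvPolynomial σ F}
    (hφ : φ.IsHomogeneous 1) (h0 : φ ≠ 0) : Irreducible φ := by
  refine irreducible_of_totalDegree_eq_one (hφ.totalDegree h0) fun x hx => ?_
  obtain ⟨s, hs⟩ := ne_zero_iff.1 h0
  exact isUnit_iff_ne_zero.2 (ne_zero_of_dvd_ne_zero hs (hx s))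

theorem irreducible_linearForm {α β : F} (h : (α, β) ≠ (0, 0)) :
    Irreducible (C α * X 0 + C β * X 1 : MvPolynomial (Fin 2) F) := by
  refine irreducible_of_isHomogeneous_one
    ((isHomogeneous_C_mul_X α 0).add (isHomogeneous_C_mul_X β 1)) fun hzero => h ?_
  have hα : α = 0 := by simpa using congrArg (eval ![1, 0]) hzero
  have hβ : β = 0 := by simpa using congrArg (eval ![0, 1]) hzero
  rw [hα, hβ]

theorem linearForm_dvd_iff_eval_eq_zero {φ : MvPolynomial (Fin 2) F} {d : ℕ}
    (hφ : φ.IsHomogeneous d) {α β : F} (h : (α, β) ≠ (0, 0)) :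
    C α * X 0 + C β * X 1 ∣ φ ↔ eval ![β, -α] φ = 0 := by
  constructor
  · intro hdvd
    simpa [mul_comm α β] using map_dvd (eval ![β, -α]) hdvd
  · intro hzero
    obtain ⟨i, hi⟩ : ∃ i, ![β, -α] i ≠ 0 := by
      by_contra! hv
      exact h (Prod.ext (neg_eq_zero.1 (hv 1)) (hv 0))
    have hmem := C_pow_mul_sub_X_pow_mul_mem_span hφ ![β, -α] i
    rw [hzero, map_zero, mul_zero, sub_zero] at hmem
    have hspan : Ideal.span (Set.range fun j => C (![β, -α] i) * X j - C (![β, -α] j) * X i) ≤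
        Ideal.span {(C α * X 0 + C β * X 1 : MvPolynomial (Fin 2) F)} := by
      refine Ideal.span_le.2 (Set.range_subset_iff.2 fun j => Ideal.mem_span_singleton.2 ?_)
      fin_cases i <;> fin_cases j
      · simp
      · simp [add_comm]
      · exact ⟨-1, by simp; ring⟩
      · simp
    have hunit : IsUnit (C (![β, -α] i) ^ d : MvPolynomial (Fin 2) F) :=
      ((isUnit_iff_ne_zero.2 hi).map C).pow d
    exact hunit.dvd_mul_left.1 (Ideal.mem_span_singleton.1 (hspan hmem))

end HomogeneousPolynomials

section MinimalRanks

variable {F : Type*} [Field F] {m n : ℕ}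

theorem rank_eq_card_iff_det_ne_zero {ι : Type*} [Fintype ι] [DecidableEq ι] (M : Matrix ι ι F) :
    M.rank = Fintype.card ι ↔ M.det ≠ 0 := by
  refine ⟨fun h => ?_, Matrix.rank_of_det_ne_zero⟩
  rw [← isUnit_iff_ne_zero, ← Matrix.isUnit_iff_isUnit_det,
    ← Matrix.linearIndependent_rows_iff_isUnit, linearIndependent_iff_card_eq_finrank_span,
    Set.finrank, ← Matrix.rank_eq_finrank_span_row, h]

theorem exists_notMem_span_singleton {K V : Type*} [Ring K] [StrongRankCondition K]
    [AddCommGroup V] [Module K V] (hV : 1 < Module.finrank K V) (v : V) :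
    ∃ w, w ∉ Submodule.span K {v} := by
  by_contra! h
  have htop : Submodule.span K {v} = ⊤ := Submodule.eq_top_iff'.2 h
  have hle := finrank_span_le_card (R := K) ({v} : Set V)
  rw [htop, finrank_top, Set.toFinset_singleton, Finset.card_singleton] at hle
  exact hV.not_ge hle

theorem lowerRank_le_rankOffSpan (A B : Matrix (Fin m) (Fin n) F) (v : Fin 2 → F) :
    lowerRank A B ≤ rankOffSpan A B v := by
  obtain ⟨w, hw⟩ := exists_notMem_span_singleton (K := F) (by simp) v
  refine le_csInf ⟨_, w, hw, rfl⟩ ?_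
  rintro _ ⟨u, hu, rfl⟩
  exact Nat.sInf_le ⟨u, (ne_of_mem_of_not_mem (Submodule.zero_mem _) hu).symm, rfl⟩

theorem rankOffSpan_le_width (A B : Matrix (Fin m) (Fin n) F) (v : Fin 2 → F) :
    rankOffSpan A B v ≤ n := by
  obtain ⟨w, hw⟩ := exists_notMem_span_singleton (K := F) (by simp) v
  exact le_trans (Nat.sInf_le ⟨w, hw, rfl⟩) (Matrix.rank_le_width (comb A B w))

theorem lowerRank_eq_width_iff (A B : Matrix (Fin m) (Fin n) F) :
    lowerRank A B = n ↔ ∀ v, v ≠ 0 → (comb A B v).rank = n := by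
  constructor
  · intro h v hv
    exact (Matrix.rank_le_width _).antisymm (h.symm.trans_le (Nat.sInf_le ⟨v, hv, rfl⟩))
  · intro h
    obtain ⟨v, hv, hrank⟩ := exists_isMinimizer A B
    rw [← hrank, h v hv]

theorem minimalRanks_eq_width_iff (A B : Matrix (Fin m) (Fin n) F) :
    minimalRanks A B = (n, n) ↔ lowerRank A B = n := by
  refine ⟨congrArg Prod.snd, fun h => Prod.ext ?_ h⟩
  exact (rankOffSpan_le_width A B _).antisymm (h.symm.trans_le (lowerRank_le_rankOffSpan A B _))

end MinimalRanks

section AbsolutelyNonsingular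

variable {F : Type*} [Field F] {n : ℕ}

/-- A square pencil is absolutely nonsingular if all its members `t A + u B` with `(t, u) ≠ 0` are
invertible, in other words if the binary form `det (μ A + λ B)` is anisotropic over `F`. -/
def IsAbsolutelyNonsingular (A B : Matrix (Fin n) (Fin n) F) : Prop :=
  ∀ v : Fin 2 → F, v ≠ 0 → (comb A B v).det ≠ 0

theorem minimalRanks_eq_iff_isAbsolutelyNonsingular (A B : Matrix (Fin n) (Fin n) F) :
    minimalRanks A B = (n, n) ↔ IsAbsolutelyNonsingular A B := by
  rw [minimalRanks_eq_width_iff, lowerRank_eq_width_iff]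
  refine forall₂_congr fun v _ => ?_
  rw [← rank_eq_card_iff_det_ne_zero, Fintype.card_fin]

theorem eval_det_homog (A B : Matrix (Fin n) (Fin n) F) (v : Fin 2 → F) :
    eval v (homog A B).det = (comb A B v).det := by
  rw [RingHom.map_det]
  congr 1
  ext i j
  simp [homog, comb]

theorem isHomogeneous_det_homog (A B : Matrix (Fin n) (Fin n) F) :
    (homog A B).det.IsHomogeneous n := by
  have hentry (i j : Fin n) : (homog A B i j).IsHomogeneous 1 := by
    simpa [homog, mul_comm] using
      (isHomogeneous_C_mul_X (A i j) 0).add (isHomogeneous_C_mul_X (B i j) 1)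
  simpa using isHomogeneous_det hentry

theorem isAbsolutelyNonsingular_iff_forall_not_dvd_det (A B : Matrix (Fin n) (Fin n) F) :
    IsAbsolutelyNonsingular A B ↔
      ∀ α β : F, (α, β) ≠ (0, 0) → ¬ C α * X 0 + C β * X 1 ∣ (homog A B).det := by
  constructor
  · intro h α β hαβ hdvd
    rw [linearForm_dvd_iff_eval_eq_zero (isHomogeneous_det_homog A B) hαβ, eval_det_homog] at hdvd
    refine h _ (fun hv => hαβ ?_) hdvd
    exact Prod.ext (neg_eq_zero.1 (congrFun hv 1)) (congrFun hv 0)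
  · intro h v hv hdet
    have hne : (-v 1, v 0) ≠ (0, 0) := fun h0 => hv <| by
      obtain ⟨h1, h0⟩ := Prod.mk.inj h0
      exact funext (Fin.forall_fin_two.2 ⟨h0, neg_eq_zero.1 h1⟩)
    have hv_eq : ![v 0, -(-v 1)] = v := by
      ext i
      fin_cases i <;> simp
    refine h _ _ hne ((linearForm_dvd_iff_eval_eq_zero (isHomogeneous_det_homog A B) hne).2 ?_)
    rwa [hv_eq, eval_det_homog]

theorem IsElementaryDivisor.dvd_det {A B : Matrix (Fin n) (Fin n) F} {q : MvPolynomial (Fin 2) F}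
    (hq : IsElementaryDivisor A B q) : q ∣ (homog A B).det := by
  obtain ⟨i, p, e, hi, -, -, hpe, -, rfl⟩ := hq
  exact hpe.trans hi.dvd_det

theorem IsElementaryDivisor.not_isUnit {m : ℕ} {A B : Matrix (Fin m) (Fin n) F}
    {q : MvPolynomial (Fin 2) F} (hq : IsElementaryDivisor A B q) : ¬ IsUnit q := by
  obtain ⟨-, p, e, -, hp, he, -, -, rfl⟩ := hq
  rw [isUnit_pow_iff (Nat.one_le_iff_ne_zero.1 he)]
  exact hp.not_isUnit

theorem exists_isElementaryDivisor_pow {A B : Matrix (Fin n) (Fin n) F} (hreg : IsRegular A B)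
    {p : MvPolynomial (Fin 2) F} (hp : Irreducible p) (hdvd : p ∣ (homog A B).det) :
    ∃ e, IsElementaryDivisor A B (p ^ e) := by
  have hgcd : IsGCDMonoid (MvPolynomial (Fin 2) F) := ⟨UniqueFactorizationMonoid.toGCDMonoid _⟩
  obtain ⟨i, hi, hpi⟩ :=
    (isDeterminantalDivisor_det (homog A B)).exists_isInvariantFactor_dvd hp.prime hreg hdvd
  have hfin : FiniteMultiplicity p i := .of_not_isUnit hp.not_isUnit hi.ne_zero
  exact ⟨multiplicity p i, i, p, _, hi, hp, hfin.le_multiplicity_of_pow_dvd (by rwa [pow_one]),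
    pow_multiplicity_dvd p i, hfin.not_pow_dvd_of_multiplicity_lt (Nat.lt_succ_self _), rfl⟩

theorem isAbsolutelyNonsingular_iff_isRegular_and_forall_not_isPowerOfLinearForm
    (A B : Matrix (Fin n) (Fin n) F) :
    IsAbsolutelyNonsingular A B ↔
      IsRegular A B ∧ ∀ q : MvPolynomial (Fin 2) F, IsElementaryDivisor A B q →
        ¬ IsPowerOfLinearForm q := by
  rw [isAbsolutelyNonsingular_iff_forall_not_dvd_det]
  constructor
  · intro h
    refine ⟨fun hzero => h 1 0 (by simp) (hzero ▸ dvd_zero _), ?_⟩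
    rintro _ hq ⟨α, β, e, hαβ, rfl⟩
    have he : e ≠ 0 := by
      rintro rfl
      exact hq.not_isUnit (by simp)
    exact h α β hαβ ((dvd_pow_self _ he).trans hq.dvd_det)
  · rintro ⟨hreg, hel⟩ α β hαβ hdvd
    obtain ⟨e, he⟩ := exists_isElementaryDivisor_pow hreg (irreducible_linearForm hαβ) hdvd
    exact hel _ he ⟨α, β, e, hαβ, rfl⟩

end AbsolutelyNonsingular

section Orbits

variable {F : Type*} [Field F] {m n : ℕ}

theorem comb_act (P : Matrix.GeneralLinearGroup (Fin m) F) (U : Matrix.GeneralLinearGroup (Fin n) F)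
    (T : Matrix.GeneralLinearGroup (Fin 2) F) (A B : Matrix (Fin m) (Fin n) F) (v : Fin 2 → F) :
    comb (act P U T A B).1 (act P U T A B).2 v =
      P.val * comb A B (Matrix.vecMul v T.val) * U.val.transpose := by
  have hcomb : comb A B (Matrix.vecMul v T.val) =
      v 0 • (T.val 0 0 • A + T.val 0 1 • B) + v 1 • (T.val 1 0 • A + T.val 1 1 • B) := by
    simp only [comb, Matrix.vecMul, dotProduct, Fin.sum_univ_two]
    module
  rw [hcomb]
  simp only [comb, act, Matrix.mul_add _ (v 0 • _), Matrix.add_mul, Matrix.mul_smul,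
    Matrix.smul_mul]

theorem isAbsolutelyNonsingular_act_iff (P U : Matrix.GeneralLinearGroup (Fin n) F)
    (T : Matrix.GeneralLinearGroup (Fin 2) F) (A B : Matrix (Fin n) (Fin n) F) :
    IsAbsolutelyNonsingular (act P U T A B).1 (act P U T A B).2 ↔
      IsAbsolutelyNonsingular A B := by
  have hdet (v : Fin 2 → F) : (comb (act P U T A B).1 (act P U T A B).2 v).det ≠ 0 ↔
      (comb A B (Matrix.vecMul v T.val)).det ≠ 0 := by
    simp [comb_act, P.det_ne_zero, U.det_ne_zero]
  have hinj : Function.Injective fun v => Matrix.vecMul v T.val :=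
    Matrix.vecMul_injective_iff_isUnit.2 T.isUnit
  have hsurj : Function.Surjective fun v => Matrix.vecMul v T.val :=
    Matrix.vecMul_surjective_iff_isUnit.2 T.isUnit
  simp only [IsAbsolutelyNonsingular, hdet]
  refine Iff.trans (forall_congr' fun v => ?_) hsurj.forall.symm
  exact imp_congr_left (hinj.ne_iff' (Matrix.zero_vecMul _)).symm

theorem isAbsolutelyNonsingular_iff_of_mem_orbit {A B C D : Matrix (Fin n) (Fin n) F}
    (h : (C, D) ∈ orbit A B) : IsAbsolutelyNonsingular C D ↔ IsAbsolutelyNonsingular A B := by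
  obtain ⟨P, U, T, h⟩ := h
  rw [← isAbsolutelyNonsingular_act_iff P U T A B, ← h]

theorem inv_mul_one_mem_orbit (A : Matrix (Fin n) (Fin n) F) {B : Matrix (Fin n) (Fin n) F}
    (hB : B.det ≠ 0) : (B⁻¹ * A, 1) ∈ orbit A B := by
  refine ⟨(Matrix.GeneralLinearGroup.mkOfDetNeZero B hB)⁻¹, 1, 1, ?_⟩
  simp [act, Matrix.coe_units_inv, Matrix.GeneralLinearGroup.mkOfDetNeZero,
    Matrix.nonsing_inv_mul B (isUnit_iff_ne_zero.2 hB)]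

theorem isAbsolutelyNonsingular_iff_forall_det_sub_smul (A B : Matrix (Fin n) (Fin n) F) :
    IsAbsolutelyNonsingular A B ↔ B.det ≠ 0 ∧ ∀ x : F, (A - x • B).det ≠ 0 := by
  constructor
  · intro h
    refine ⟨?_, fun x => ?_⟩
    · simpa [comb] using h ![0, 1] (by simp)
    · simpa [comb, sub_eq_add_neg] using h ![1, -x] (by simp)
  · rintro ⟨hB, hsub⟩ v hv
    by_cases h0 : v 0 = 0
    · have h1 : v 1 ≠ 0 := fun h1 => hv (funext (Fin.forall_fin_two.2 ⟨h0, h1⟩))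
      simp [comb, h0, h1, hB]
    · have hscale : comb A B v = v 0 • (A - (-(v 1 / v 0)) • B) := by
        rw [comb, smul_sub, smul_smul, mul_neg, mul_div_cancel₀ _ h0, neg_smul, sub_neg_eq_add]
      rw [hscale, Matrix.det_smul]
      exact mul_ne_zero (pow_ne_zero _ h0) (hsub _)

theorem hasEigenvalue_toLin'_iff_det_sub_smul_one {ι : Type*} [Fintype ι] [DecidableEq ι]
    (Q : Matrix ι ι F) (x : F) :
    Module.End.HasEigenvalue (Matrix.toLin' Q) x ↔ (Q - x • 1).det = 0 := by
  rw [Module.End.hasEigenvalue_iff_mem_spectrum, Matrix.spectrum_toLin', spectrum.mem_iff,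
    ← IsUnit.sub_iff, Matrix.isUnit_iff_isUnit_det, isUnit_iff_ne_zero, not_not,
    Algebra.algebraMap_eq_smul_one]

theorem isAbsolutelyNonsingular_one_iff (Q : Matrix (Fin n) (Fin n) F) :
    IsAbsolutelyNonsingular Q 1 ↔ ∀ x : F, ¬ Module.End.HasEigenvalue (Matrix.toLin' Q) x := by
  simp [isAbsolutelyNonsingular_iff_forall_det_sub_smul, hasEigenvalue_toLin'_iff_det_sub_smul_one]

theorem isAbsolutelyNonsingular_iff_exists_mem_orbit (A B : Matrix (Fin n) (Fin n) F) :
    IsAbsolutelyNonsingular A B ↔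
      ∃ Q : Matrix (Fin n) (Fin n) F, (Q, (1 : Matrix (Fin n) (Fin n) F)) ∈ orbit A B ∧
        ∀ x : F, ¬ Module.End.HasEigenvalue (Matrix.toLin' Q) x := by
  simp only [← isAbsolutelyNonsingular_one_iff]
  constructor
  · intro h
    have hB : B.det ≠ 0 := ((isAbsolutelyNonsingular_iff_forall_det_sub_smul A B).1 h).1
    have hmem := inv_mul_one_mem_orbit A hB
    exact ⟨B⁻¹ * A, hmem, (isAbsolutelyNonsingular_iff_of_mem_orbit hmem).2 h⟩
  · rintro ⟨Q, hmem, hQ⟩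
    exact (isAbsolutelyNonsingular_iff_of_mem_orbit hmem).1 hQ

end Orbits

end MatrixPencil

theorem mainTheorem5_general {F : Type*} [Field F] (n : ℕ) (A B : Matrix (Fin n) (Fin n) F) :
    (MatrixPencil.minimalRanks A B = (n, n) ↔
      MatrixPencil.IsRegular A B ∧
        ∀ q : MvPolynomial (Fin 2) F, MatrixPencil.IsElementaryDivisor A B q →
          ¬ MatrixPencil.IsPowerOfLinearForm q) ∧
    (MatrixPencil.minimalRanks A B = (n, n) ↔
      ∃ Q : Matrix (Fin n) (Fin n) F,
        (Q, (1 : Matrix (Fin n) (Fin n) F)) ∈ MatrixPencil.orbit A B ∧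
          ∀ x : F, ¬ Module.End.HasEigenvalue (Matrix.toLin' Q) x) := by
  rw [MatrixPencil.minimalRanks_eq_iff_isAbsolutelyNonsingular]
  exact ⟨MatrixPencil.isAbsolutelyNonsingular_iff_isRegular_and_forall_not_isPowerOfLinearForm A B,
    MatrixPencil.isAbsolutelyNonsingular_iff_exists_mem_orbit A B⟩

theorem mainTheorem5 {F : Type*} [Field F] (n : ℕ) (A B : Matrix (Fin n) (Fin n) F)
    (A' B' : Matrix (Fin n) (Fin n) ℝ) :
    (MatrixPencil.minimalRanks A B = (n, n) ↔
      MatrixPencil.IsRegular A B ∧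
        ∀ q : MvPolynomial (Fin 2) F, MatrixPencil.IsElementaryDivisor A B q →
          ¬ MatrixPencil.IsPowerOfLinearForm q) ∧
    (MatrixPencil.minimalRanks A' B' = (n, n) ↔
      ∃ Q : Matrix (Fin n) (Fin n) ℝ,
        (Q, (1 : Matrix (Fin n) (Fin n) ℝ)) ∈ MatrixPencil.orbit A' B' ∧
          ∀ x : ℝ, ¬ Module.End.HasEigenvalue (Matrix.toLin' Q) x) :=
  ⟨(mainTheorem5_general n A B).1, (mainTheorem5_general n A' B').2⟩
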